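/- Let $S$ be a (non-empty) inverse semigroup, i.e. a semigroup in which every $s$ has exactly one $x$ with $sxs=s$ and $xsx=x$. Call a semigroup $T$ right noetherian if every right congruence on $T$ (an equivalence relation $\rho$ on $T$ such that $a\,\rho\,b$ implies $ac\,\rho\,bc$ for all $c\in T$) is finitely generated, i.e. is the smallest right congruence on $T$ containing some finite subset of $T\times T$. If $S$ is right noetherian, then for every monoid $M$ the direct product $S\times M$ is right noetherian if and only if $M$ is right noetherian. -/

import Mathlib

/-- A right congruence on `S`: an equivalence relation compatible with multiplication
on the right. -/
structure RightCongruence (S : Type*) [Semigroup S] extends Setoid S where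
  mul_right : ∀ a b c : S, r a b → r (a * c) (b * c)

namespace RightCongruence

/-- `ρ` is generated by `X ⊆ S × S`: it is the smallest right congruence on `S`
containing `X`. -/
def IsGeneratedBy {S : Type*} [Semigroup S] (ρ : RightCongruence S) (X : Set (S × S)) : Prop :=
  (∀ p ∈ X, ρ.r p.1 p.2) ∧
    ∀ σ : RightCongruence S, (∀ p ∈ X, σ.r p.1 p.2) → ∀ a b : S, ρ.r a b → σ.r a b

/-- `ρ` is finitely generated as a right congruence. -/
def FinitelyGenerated {S : Type*} [Semigroup S] (ρ : RightCongruence S) : Prop :=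
  ∃ X : Set (S × S), X.Finite ∧ ρ.IsGeneratedBy X

end RightCongruence

/-- A semigroup is right noetherian if every right congruence on it is finitely generated. -/
def IsRightNoetherianSemigroup (S : Type*) [Semigroup S] : Prop :=
  ∀ ρ : RightCongruence S, ρ.FinitelyGenerated

/-- An inverse semigroup: every element `s` has exactly one (von Neumann) inverse, that is,
exactly one `x` with `s x s = s` and `x s x = x`. -/
def IsInverseSemigroup (S : Type*) [Semigroup S] : Prop :=
  ∀ s : S, ∃! x : S, s * x * s = s ∧ x * s * x = x

/-! Work with the subcongruences `σ` of `ρ` containing a large enough finite part of `ρ`, and show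
that eventually `σ = ρ`. The semigroup `S` has finitely many idempotents, and divisibility on `M` is
a well-quasi-order, so three kinds of finite data suffice: pairs with equal `M`-coordinate
(`eventually_fiber`), pairs twisted by a maximal subgroup of `S` (`eventually_unitRel`), and one
pair for each generator of the right ideals of `M` attached to pairs of idempotents
(`eventually_domain`). An arbitrary pair splits into two fiber steps and one step along an arrow of
the groupoid of inverse pairs. -/

/-! ### Right congruences and their finite approximations -/

namespace RightCongruence

variable {S : Type*} [Semigroup S]

/-- The right congruences contained in `ρ` that contain sufficiently large finite subsets of `ρ`. -/
def finiteApprox (ρ : RightCongruence S) : Filter (RightCongruence S) where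
  sets := {P | ∃ X : Set (S × S), X.Finite ∧ (∀ p ∈ X, ρ.r p.1 p.2) ∧
    ∀ σ : RightCongruence S, (∀ a b, σ.r a b → ρ.r a b) → (∀ p ∈ X, σ.r p.1 p.2) → σ ∈ P}
  univ_sets := ⟨∅, Set.finite_empty, by simp, by simp⟩
  sets_of_superset := by
    rintro P Q ⟨X, hX, hρ, h⟩ hPQ
    exact ⟨X, hX, hρ, fun σ h1 h2 => hPQ (h σ h1 h2)⟩
  inter_sets := by
    rintro P Q ⟨X, hX, hρ, h⟩ ⟨Y, hY, hρ', h'⟩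
    refine ⟨X ∪ Y, hX.union hY, ?_, fun σ h1 h2 => ⟨h σ h1 fun p hp => h2 p (Or.inl hp),
      h' σ h1 fun p hp => h2 p (Or.inr hp)⟩⟩
    rintro p (hp | hp)
    exacts [hρ p hp, hρ' p hp]

theorem eventually_le (ρ : RightCongruence S) :
    ∀ᶠ σ in ρ.finiteApprox, ∀ a b, σ.r a b → ρ.r a b :=
  ⟨∅, Set.finite_empty, by simp, fun _ h _ => h⟩

theorem eventually_rel (ρ : RightCongruence S) {a b : S} (h : ρ.r a b) :
    ∀ᶠ σ in ρ.finiteApprox, σ.r a b :=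
  ⟨{(a, b)}, Set.finite_singleton _, by simpa using h, fun σ _ hσ => by simpa using hσ⟩

/-- The intersection of two right congruences. -/
def inter (ρ σ : RightCongruence S) : RightCongruence S where
  r a b := ρ.r a b ∧ σ.r a b
  iseqv := ⟨fun a => ⟨ρ.iseqv.refl a, σ.iseqv.refl a⟩,
    fun h => ⟨ρ.iseqv.symm h.1, σ.iseqv.symm h.2⟩,
    fun h h' => ⟨ρ.iseqv.trans h.1 h'.1, σ.iseqv.trans h.2 h'.2⟩⟩
  mul_right a b c h := ⟨ρ.mul_right a b c h.1, σ.mul_right a b c h.2⟩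

/-- The filter only sees subcongruences of `ρ`, so a competing `σ` is first intersected with `ρ`. -/
theorem finitelyGenerated_of_eventually (ρ : RightCongruence S)
    (h : ∀ᶠ σ in ρ.finiteApprox, ∀ a b, ρ.r a b → σ.r a b) : ρ.FinitelyGenerated := by
  obtain ⟨X, hX, hρ, h⟩ := h
  exact ⟨X, hX, hρ, fun σ hσ a b hab =>
    (h (σ.inter ρ) (fun _ _ h => h.2) (fun p hp => ⟨hσ p hp, hρ p hp⟩) a b hab).1⟩

/-- The union of an ascending sequence of right congruences. -/
def iUnion (ρ : ℕ → RightCongruence S)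
    (hρ : ∀ i j, i ≤ j → ∀ a b, (ρ i).r a b → (ρ j).r a b) : RightCongruence S where
  r a b := ∃ i, (ρ i).r a b
  iseqv := ⟨fun a => ⟨0, (ρ 0).iseqv.refl a⟩,
    fun ⟨i, h⟩ => ⟨i, (ρ i).iseqv.symm h⟩,
    fun ⟨i, h⟩ ⟨j, h'⟩ => ⟨max i j, (ρ _).iseqv.trans (hρ _ _ (le_max_left _ _) _ _ h)
      (hρ _ _ (le_max_right _ _) _ _ h')⟩⟩
  mul_right a b c := fun ⟨i, h⟩ => ⟨i, (ρ i).mul_right a b c h⟩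

/-- The pullback of a right congruence along a multiplicative map. -/
def comap {T : Type*} [Semigroup T] (f : S →ₙ* T) (ρ : RightCongruence T) :
    RightCongruence S where
  r a b := ρ.r (f a) (f b)
  iseqv := ⟨fun a => ρ.iseqv.refl _, fun h => ρ.iseqv.symm h, fun h h' => ρ.iseqv.trans h h'⟩
  mul_right a b c h := by simpa only [map_mul] using ρ.mul_right _ _ (f c) h

/-- The Rees right congruence of a right ideal. -/
def rees (I : Set S) (hI : ∀ a ∈ I, ∀ c, a * c ∈ I) : RightCongruence S where
  r a b := a = b ∨ a ∈ I ∧ b ∈ I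
  iseqv := by
    refine ⟨fun a => Or.inl rfl, ?_, ?_⟩
    · rintro a b (rfl | h)
      exacts [Or.inl rfl, Or.inr h.symm]
    · rintro a b c (rfl | h) (rfl | h')
      exacts [Or.inl rfl, Or.inr h', Or.inr h, Or.inr ⟨h.1, h'.2⟩]
  mul_right := by
    rintro a b c (rfl | h)
    exacts [Or.inl rfl, Or.inr ⟨hI _ h.1 c, hI _ h.2 c⟩]

/-- The right congruence of pairs with the same left multiple by `e`. -/
def leftKernel (e : S) : RightCongruence S where
  r a b := e * a = e * b
  iseqv := ⟨fun _ => rfl, Eq.symm, Eq.trans⟩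
  mul_right a b c h := by rw [← mul_assoc, h, mul_assoc]

/-- The right congruence on `S` obtained by fixing the second coordinate. -/
def fiber {M : Type*} [Monoid M] (ρ : RightCongruence (S × M)) (m : M) : RightCongruence S where
  r a b := ρ.r (a, m) (b, m)
  iseqv := ⟨fun _ => ρ.iseqv.refl _, fun h => ρ.iseqv.symm h, fun h h' => ρ.iseqv.trans h h'⟩
  mul_right a b c h := by simpa using ρ.mul_right _ _ (c, 1) h

/-- `S` may lack an identity, so local right identities `f`, `g` replace it; since they commute, `a
~ b * f ~ a * g ~ b` over `n`. -/
theorem fiber_mono {M : Type*} [Monoid M] (ρ : RightCongruence (S × M)) {m n : M} (h : m ∣ n)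
    {a b f g : S} (ha : a * f = a) (hb : b * g = b) (hfg : f * g = g * f)
    (hab : (ρ.fiber m).r a b) : (ρ.fiber n).r a b := by
  obtain ⟨c, rfl⟩ := h
  have h1 : ρ.r (a, m * c) (b * f, m * c) := by simpa [ha] using ρ.mul_right _ _ (f, c) hab
  have h2 : ρ.r (a * g, m * c) (b, m * c) := by simpa [hb] using ρ.mul_right _ _ (g, c) hab
  have h3 : ρ.r (a * g, m * c) (b * f, m * c) := by
    have := ρ.mul_right _ _ (f * g, c) hab
    rwa [Prod.mk_mul_mk, Prod.mk_mul_mk, ← mul_assoc, ha, hfg, ← mul_assoc, hb] at this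
  exact ρ.iseqv.trans h1 (ρ.iseqv.trans (ρ.iseqv.symm h3) h2)

end RightCongruence

theorem exists_finite_basis {α : Type*} {r : α → α → Prop} (hr : WellQuasiOrdered r)
    (s : Set α) : ∃ t ⊆ s, t.Finite ∧ ∀ x ∈ s, ∃ y ∈ t, r y x := by
  by_contra! H
  obtain ⟨f, -, hf⟩ := exists_seq_of_forall_finset_exists (· ∈ s) (fun y x => ¬ r y x)
    fun t ht => H t ht t.finite_toSet
  obtain ⟨m, n, hmn, h⟩ := hr f
  exact hf m n hmn h

/-! ### Inverse pairs and commuting idempotents -/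

/-- `x` and `y` are mutually inverse. -/
def InversePair {S : Type*} [Semigroup S] (x y : S) : Prop := x * y * x = x ∧ y * x * y = y

namespace InversePair

variable {S : Type*} [Semigroup S] {x y z w : S}

theorem symm (h : InversePair x y) : InversePair y x := ⟨h.2, h.1⟩

theorem isIdempotentElem (h : InversePair x y) : x * y * (x * y) = x * y := by
  rw [← mul_assoc, h.1]

/-- Composition of inverse pairs with matching middle idempotent. -/
theorem comp (h : InversePair x y) (h' : InversePair z w) (he : y * x = z * w) :
    InversePair (x * z) (w * y) ∧ x * z * (w * y) = x * y ∧ w * y * (x * z) = w * z := by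
  have h1 : x * z * (w * y) = x * y := by
    rw [mul_assoc, ← mul_assoc z, ← he, h.2]
  have h2 : w * y * (x * z) = w * z := by
    rw [mul_assoc, ← mul_assoc y, he, h'.1]
  refine ⟨⟨?_, ?_⟩, h1, h2⟩
  · rw [h1, ← mul_assoc, h.1]
  · rw [h2, ← mul_assoc, h'.2]

end InversePair

namespace IsInverseSemigroup

variable {S : Type*} [Semigroup S]

theorem exists_inversePair (hS : IsInverseSemigroup S) (s : S) : ∃ t, InversePair s t :=
  (hS s).exists

/-- The inverse `x` of `e * f` equals `f * x * e`, hence is idempotent and its own inverse, so `e *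
f = x`. -/
theorem mul_idempotent (hS : IsInverseSemigroup S) {e f : S} (he : e * e = e) (hf : f * f = f) :
    e * f * (e * f) = e * f := by
  obtain ⟨x, hx, hx'⟩ := hS.exists_inversePair (e * f)
  have he' (a : S) : e * (e * a) = e * a := by rw [← mul_assoc, he]
  have hf' (a : S) : f * (f * a) = f * a := by rw [← mul_assoc, hf]
  simp only [mul_assoc] at hx hx'
  have hx'' : x * (e * (f * (x * e))) = x * e := by
    simpa only [mul_assoc] using congrArg (· * e) hx'
  have h1 : x = f * (x * e) := by
    refine (hS (e * f)).unique ⟨?_, ?_⟩ ⟨?_, ?_⟩ <;> simp only [mul_assoc, he', hf', hx, hx', hx'']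
  have h2 : x * x = x := by
    conv_lhs => rw [h1]
    simp only [mul_assoc, hx'']
    exact h1.symm
  have h3 : e * f = x := by
    refine (hS x).unique ⟨?_, ?_⟩ ⟨?_, ?_⟩ <;> simp only [mul_assoc, hx, hx', h2]
  rw [h3, h2]

theorem idempotents_commute (hS : IsInverseSemigroup S) {e f : S} (he : e * e = e)
    (hf : f * f = f) : e * f = f * e := by
  have h1 := hS.mul_idempotent he hf
  have h2 := hS.mul_idempotent hf he
  have he' (a : S) : e * (e * a) = e * a := by rw [← mul_assoc, he]
  have hf' (a : S) : f * (f * a) = f * a := by rw [← mul_assoc, hf]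
  refine (hS (e * f)).unique ⟨?_, ?_⟩ ⟨?_, ?_⟩ <;> simp only [mul_assoc, he', hf'] at * <;>
    simp only [h1, h2]

end IsInverseSemigroup

/-! ### Consequences of the noetherian condition -/

namespace IsRightNoetherianSemigroup

variable {S : Type*} [Semigroup S]

theorem ascending_chain_condition (hS : IsRightNoetherianSemigroup S) (ρ : ℕ → RightCongruence S)
    (hρ : ∀ i j, i ≤ j → ∀ a b, (ρ i).r a b → (ρ j).r a b) :
    ∃ n, ∀ m a b, (ρ m).r a b → (ρ n).r a b := by
  obtain ⟨X, hX, h1, h2⟩ := hS (RightCongruence.iUnion ρ hρ)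
  have : ∀ᶠ n in Filter.atTop, ∀ p ∈ X, (ρ n).r p.1 p.2 := by
    rw [Filter.eventually_all_finite hX]
    intro p hp
    obtain ⟨i, hi⟩ := h1 p hp
    filter_upwards [Filter.eventually_ge_atTop i] with n hn using hρ i n hn _ _ hi
  obtain ⟨n, hn⟩ := this.exists
  exact ⟨n, fun m a b h => h2 (ρ n) hn a b ⟨m, h⟩⟩

theorem of_surjective {T : Type*} [Semigroup T] (hS : IsRightNoetherianSemigroup S) (f : S →ₙ* T)
    (hf : Function.Surjective f) : IsRightNoetherianSemigroup T := by
  intro ρ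
  obtain ⟨X, hX, h1, h2⟩ := hS (ρ.comap f)
  refine ⟨Prod.map f f '' X, hX.image _, ?_, fun σ hσ a b hab => ?_⟩
  · rintro _ ⟨p, hp, rfl⟩
    exact h1 p hp
  · obtain ⟨a, rfl⟩ := hf a
    obtain ⟨b, rfl⟩ := hf b
    exact h2 (σ.comap f) (fun p hp => hσ _ ⟨p, hp, rfl⟩) a b hab

/-- The Rees congruences of the right ideals generated by initial segments of the sequence
stabilise. -/
theorem wellQuasiOrdered (hS : IsRightNoetherianSemigroup S) :
    WellQuasiOrdered (fun a b : S => a = b ∨ a ∣ b) := by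
  intro u
  let I (n : ℕ) : Set S := {s | ∃ i ≤ n, u i = s ∨ u i ∣ s}
  have hI (n : ℕ) : ∀ a ∈ I n, ∀ c, a * c ∈ I n := by
    rintro a ⟨i, hi, rfl | h⟩ c
    exacts [⟨i, hi, Or.inr (dvd_mul_right _ _)⟩, ⟨i, hi, Or.inr (h.mul_right c)⟩]
  obtain ⟨n, hn⟩ := hS.ascending_chain_condition (fun n => .rees (I n) (hI n)) (by
    rintro i j hij a b (h | ⟨⟨k, hk, ha⟩, l, hl, hb⟩)
    exacts [Or.inl h, Or.inr ⟨⟨k, hk.trans hij, ha⟩, l, hl.trans hij, hb⟩])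
  rcases hn (n + 1) (u (n + 1)) (u 0) (Or.inr ⟨⟨n + 1, le_rfl, Or.inl rfl⟩, 0, by omega, Or.inl rfl⟩)
    with h | ⟨⟨i, hi, h⟩, -⟩
  · exact ⟨0, n + 1, by omega, Or.inl h.symm⟩
  · exact ⟨i, n + 1, by omega, h⟩

theorem wellQuasiOrdered_dvd {M : Type*} [Monoid M] (hM : IsRightNoetherianSemigroup M) :
    WellQuasiOrdered (fun a b : M => a ∣ b) := by
  intro u
  obtain ⟨i, j, hij, h⟩ := hM.wellQuasiOrdered u
  exact ⟨i, j, hij, h.elim (fun h => h ▸ dvd_rfl) id⟩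

/-- Distinct idempotents would contain a descending sequence; their left kernels ascend, and
stabilising forces two consecutive terms to coincide. -/
theorem finite_idempotents (hS : IsRightNoetherianSemigroup S)
    (hc : ∀ e f : S, e * e = e → f * f = f → e * f = f * e) : {e : S | e * e = e}.Finite := by
  by_contra hinf
  have hinf : {e : S | e * e = e}.Infinite := hinf
  let u := hinf.natEmbedding
  have : IsPreorder S (fun a b : S => a = b ∨ a ∣ b) :=
    { refl := fun a => Or.inl rfl
      trans := by
        rintro a b c (rfl | h) (rfl | h')
        exacts [Or.inl rfl, Or.inr h', Or.inr h, Or.inr (dvd_trans h h')] }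
  obtain ⟨g, hg⟩ := hS.wellQuasiOrdered.exists_monotone_subseq (fun n => (u n : S))
  have hidem (n : ℕ) : (u n : S) * u n = u n := (u n).2
  have hmul (i j : ℕ) (hij : i ≤ j) : (u (g i) : S) * u (g j) = u (g j) := by
    rcases hg i j hij with h | ⟨c, h⟩
    · rw [← h, hidem]
    · rw [h, ← mul_assoc, hidem]
  obtain ⟨n, hn⟩ := hS.ascending_chain_condition (fun n => .leftKernel (u (g n) : S)) (by
    intro i j hij a b h
    have h' : (u (g i) : S) * a = u (g i) * b := h
    change (u (g j) : S) * a = u (g j) * b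
    rw [← hmul i j hij, hc _ _ (hidem _) (hidem _), mul_assoc, mul_assoc, h'])
  have h := hn (n + 1) (u (g n)) (u (g (n + 1))) (by
    change (u (g (n + 1)) : S) * _ = u (g (n + 1)) * _
    rw [hidem, hc _ _ (hidem _) (hidem _), hmul n (n + 1) (by omega)])
  have h' : (u (g n) : S) * u (g n) = u (g n) * u (g (n + 1)) := h
  rw [hidem, hmul n (n + 1) (by omega)] at h'
  have := g.injective (u.injective (Subtype.ext h'))
  omega

end IsRightNoetherianSemigroup

/-! ### Finite generation over the product -/

namespace RightCongruence

variable {S M : Type*} [Semigroup S] [Monoid M]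

/-- Elements `m`, `n` of `M` are related if `(h, m)` is related to `(e, n)` for some `h` in the
maximal subgroup of `S` with identity `e`. -/
def unitRel (ρ : RightCongruence (S × M)) (e : S) (he : e * e = e) : RightCongruence M where
  r m n := ∃ h k, InversePair h k ∧ h * k = e ∧ k * h = e ∧ ρ.r (h, m) (e, n)
  iseqv := by
    refine ⟨fun m => ⟨e, e, ⟨by simp [he], by simp [he]⟩, he, he, ρ.iseqv.refl _⟩, ?_, ?_⟩
    · rintro m n ⟨h, k, hk, rfl, hkh, hr⟩
      refine ⟨k, h, hk.symm, hkh, rfl, ?_⟩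
      have := ρ.mul_right _ _ (k, 1) hr
      rw [Prod.mk_mul_mk, Prod.mk_mul_mk, mul_one, mul_one, ← hkh, hk.2, hkh] at this
      exact ρ.iseqv.symm this
    · rintro m n p ⟨h, k, hk, hhk, hkh, hr⟩ ⟨h', k', hk', hhk', hkh', hr'⟩
      obtain ⟨h1, h2, h3⟩ := hk.comp hk' (hkh.trans hhk'.symm)
      refine ⟨h * h', k' * k, h1, h2.trans hhk, h3.trans hkh', ?_⟩
      have := ρ.mul_right _ _ (h', 1) hr
      rw [Prod.mk_mul_mk, Prod.mk_mul_mk, mul_one, mul_one, ← hhk', hk'.1] at this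
      exact ρ.iseqv.trans this hr'
  mul_right := by
    rintro m n c ⟨h, k, hk, hhk, hkh, hr⟩
    refine ⟨h, k, hk, hhk, hkh, ?_⟩
    have := ρ.mul_right _ _ (e, c) hr
    rwa [Prod.mk_mul_mk, Prod.mk_mul_mk, he, ← hkh, ← mul_assoc, hk.1, hkh] at this

/-- Fibers grow along divisibility and satisfy the ascending chain condition, so finitely many `m`
determine all of them. -/
theorem eventually_fiber (hinv : IsInverseSemigroup S) (hS : IsRightNoetherianSemigroup S)
    (hM : IsRightNoetherianSemigroup M) (ρ : RightCongruence (S × M)) :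
    ∀ᶠ σ in ρ.finiteApprox, ∀ m a b, ρ.r (a, m) (b, m) → σ.r (a, m) (b, m) := by
  have mono (σ : RightCongruence (S × M)) {m n : M} (h : m ∣ n) (a b : S)
      (hab : (σ.fiber m).r a b) : (σ.fiber n).r a b := by
    obtain ⟨a', ha⟩ := hinv.exists_inversePair a
    obtain ⟨b', hb⟩ := hinv.exists_inversePair b
    exact σ.fiber_mono h (f := a' * a) (g := b' * b) (by rw [← mul_assoc, ha.1])
      (by rw [← mul_assoc, hb.1]) (hinv.idempotents_commute ha.symm.isIdempotentElem
        hb.symm.isIdempotentElem) hab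
  have wqo : WellQuasiOrdered
      (fun m n : M => m ∣ n ∧ ∀ a b, (ρ.fiber n).r a b → (ρ.fiber m).r a b) := by
    intro u
    have : IsPreorder M (fun a b : M => a ∣ b) :=
      { refl := fun a => dvd_rfl, trans := fun a b c => dvd_trans }
    obtain ⟨g, hg⟩ := hM.wellQuasiOrdered_dvd.exists_monotone_subseq u
    obtain ⟨n, hn⟩ := hS.ascending_chain_condition (fun n => ρ.fiber (u (g n)))
      fun i j hij => mono ρ (hg i j hij)
    exact ⟨g n, g (n + 1), g.strictMono (by omega), hg n (n + 1) (by omega), hn (n + 1)⟩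
  obtain ⟨t, -, ht, hbasis⟩ := exists_finite_basis wqo Set.univ
  have : ∀ᶠ σ in ρ.finiteApprox, ∀ m ∈ t, ∀ a b, (ρ.fiber m).r a b → (σ.fiber m).r a b := by
    rw [Filter.eventually_all_finite ht]
    intro m _
    obtain ⟨X, hX, h1, h2⟩ := hS (ρ.fiber m)
    have : ∀ᶠ σ in ρ.finiteApprox, ∀ p ∈ X, σ.r (p.1, m) (p.2, m) := by
      rw [Filter.eventually_all_finite hX]
      exact fun p hp => ρ.eventually_rel (h1 p hp)
    filter_upwards [this] with σ hσ using h2 (σ.fiber m) hσ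
  filter_upwards [this] with σ hσ n a b hab
  obtain ⟨m, hm, hmn, h⟩ := hbasis n trivial
  exact mono σ hmn a b (hσ m hm a b (h a b hab))

theorem eventually_unitRel (hM : IsRightNoetherianSemigroup M) (ρ : RightCongruence (S × M))
    (e : S) (he : e * e = e) :
    ∀ᶠ σ in ρ.finiteApprox, ∀ m n, (ρ.unitRel e he).r m n → (σ.unitRel e he).r m n := by
  obtain ⟨X, hX, h1, h2⟩ := hM (ρ.unitRel e he)
  have : ∀ᶠ σ in ρ.finiteApprox, ∀ p ∈ X, (σ.unitRel e he).r p.1 p.2 := by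
    rw [Filter.eventually_all_finite hX]
    intro p hp
    obtain ⟨h, k, hk, hhk, hkh, hr⟩ := h1 p hp
    filter_upwards [ρ.eventually_rel hr] with σ hσ using ⟨h, k, hk, hhk, hkh, hσ⟩
  filter_upwards [this] with σ hσ using h2 _ hσ

theorem eventually_domain (hM : IsRightNoetherianSemigroup M) (ρ : RightCongruence (S × M))
    (f e : S) :
    ∀ᶠ σ in ρ.finiteApprox, ∀ m n x y, InversePair x y → x * y = f → y * x = e →
      ρ.r (x, m) (e, n) →
      ∃ x' y' n', InversePair x' y' ∧ x' * y' = f ∧ y' * x' = e ∧ σ.r (x', m) (e, n') := by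
  obtain ⟨t, hts, ht, hbasis⟩ := exists_finite_basis hM.wellQuasiOrdered_dvd
    {m | ∃ x y n, InversePair x y ∧ x * y = f ∧ y * x = e ∧ ρ.r (x, m) (e, n)}
  have : ∀ᶠ σ in ρ.finiteApprox, ∀ m ∈ t,
      ∃ x y n, InversePair x y ∧ x * y = f ∧ y * x = e ∧ σ.r (x, m) (e, n) := by
    rw [Filter.eventually_all_finite ht]
    intro m hm
    obtain ⟨x, y, n, hxy, hf, he, hr⟩ := hts hm
    filter_upwards [ρ.eventually_rel hr] with σ hσ using ⟨x, y, n, hxy, hf, he, hσ⟩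
  filter_upwards [this] with σ hσ m n x y hxy hf he hr
  obtain ⟨m', hm', c, rfl⟩ := hbasis m ⟨x, y, n, hxy, hf, he, hr⟩
  obtain ⟨x', y', n', hxy', hf', he', hr'⟩ := hσ m' hm'
  refine ⟨x', y', n' * c, hxy', hf', he', ?_⟩
  have := σ.mul_right _ _ (y' * x', c) hr'
  rwa [Prod.mk_mul_mk, Prod.mk_mul_mk, ← mul_assoc x', hxy'.1, ← he',
    hxy'.symm.isIdempotentElem, he'] at this

theorem finitelyGenerated_prod (hinv : IsInverseSemigroup S) (hS : IsRightNoetherianSemigroup S)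
    (hM : IsRightNoetherianSemigroup M) (ρ : RightCongruence (S × M)) : ρ.FinitelyGenerated := by
  have hE := hS.finite_idempotents fun e f => hinv.idempotents_commute
  have hunit : ∀ᶠ σ in ρ.finiteApprox, ∀ e ∈ {e : S | e * e = e}, ∀ he : e * e = e, ∀ m n,
      (ρ.unitRel e he).r m n → (σ.unitRel e he).r m n := by
    rw [Filter.eventually_all_finite hE]
    intro e he
    filter_upwards [ρ.eventually_unitRel hM e he] with σ hσ _ using hσ
  have hdom : ∀ᶠ σ in ρ.finiteApprox, ∀ f ∈ {e : S | e * e = e}, ∀ e ∈ {e : S | e * e = e},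
      ∀ m n x y, InversePair x y → x * y = f → y * x = e → ρ.r (x, m) (e, n) →
      ∃ x' y' n', InversePair x' y' ∧ x' * y' = f ∧ y' * x' = e ∧ σ.r (x', m) (e, n') := by
    rw [Filter.eventually_all_finite hE]
    intro f _
    rw [Filter.eventually_all_finite hE]
    exact fun e _ => ρ.eventually_domain hM f e
  apply finitelyGenerated_of_eventually
  filter_upwards [ρ.eventually_le, ρ.eventually_fiber hinv hS hM, hunit, hdom]
    with σ hle hfib hunit hdom
  have group (h k e : S) (m n : M) (hk : InversePair h k) (hhk : h * k = e) (hkh : k * h = e)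
      (hr : ρ.r (h, m) (e, n)) : σ.r (h, m) (e, n) := by
    have he : e * e = e := by rw [← hhk, hk.isIdempotentElem]
    obtain ⟨h', k', hk', hhk', hkh', hr'⟩ := hunit e he he m n ⟨h, k, hk, hhk, hkh, hr⟩
    have heh : e * h = h := by rw [← hhk, hk.1]
    have hek : e * k' = k' := by rw [← hkh', hk'.2]
    -- This moves `(h, m)` to `(k' * h, n)`, which differs from `(e, n)` only within a fiber.
    have h1 := σ.mul_right _ _ (k' * h, 1) hr'
    rw [Prod.mk_mul_mk, Prod.mk_mul_mk, mul_one, mul_one, ← mul_assoc, hhk', ← mul_assoc e, heh, hek] at h1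
    exact σ.iseqv.trans h1 (hfib _ _ _ (ρ.iseqv.trans (ρ.iseqv.symm (hle _ _ h1)) hr))
  have groupoid (x y : S) (m n : M) (hxy : InversePair x y) (hr : ρ.r (x, m) (y * x, n)) :
      σ.r (x, m) (y * x, n) := by
    obtain ⟨x', y', n', hxy', hf, he, hr'⟩ := hdom (x * y) hxy.isIdempotentElem (y * x)
      hxy.symm.isIdempotentElem m n x y hxy rfl rfl hr
    -- The arrow `x'` differs from `x` by the group element `y' * x`, left to `group`.
    have h1 := σ.mul_right _ _ (y' * x, 1) hr'
    rw [Prod.mk_mul_mk, Prod.mk_mul_mk, mul_one, mul_one, ← mul_assoc, hf, hxy.1, ← he,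
      ← mul_assoc (y' * x'), hxy'.2] at h1
    obtain ⟨h2, h3, h4⟩ := hxy'.symm.comp hxy hf
    exact σ.iseqv.trans h1 (group _ _ _ n' n h2 (h3.trans he) h4
      (ρ.iseqv.trans (ρ.iseqv.symm (hle _ _ h1)) hr))
  rintro ⟨s, m⟩ ⟨t, n⟩ hr
  obtain ⟨s', hs⟩ := hinv.exists_inversePair s
  obtain ⟨t', ht⟩ := hinv.exists_inversePair t
  obtain ⟨f, hf⟩ : ∃ f, f = s' * s := ⟨_, rfl⟩
  obtain ⟨g, hg⟩ : ∃ g, g = t' * t := ⟨_, rfl⟩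
  have hff : f * f = f := by rw [hf, hs.symm.isIdempotentElem]
  have hgg : g * g = g := by rw [hg, ht.symm.isIdempotentElem]
  have hfg := hinv.idempotents_commute hff hgg
  have hsf : s * f = s := by rw [hf, ← mul_assoc, hs.1]
  have htg : t * g = t := by rw [hg, ← mul_assoc, ht.1]
  have hr1 : ρ.r (s * g, m) (t, n) := by simpa [htg] using ρ.mul_right _ _ (g, 1) hr
  have hr2 : ρ.r (s, m) (t * f, n) := by simpa [hsf] using ρ.mul_right _ _ (f, 1) hr
  have h1 := hfib _ _ _ (ρ.iseqv.trans hr (ρ.iseqv.symm hr1))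
  have h2 := hfib _ _ _ (ρ.iseqv.trans (ρ.iseqv.symm hr2) hr)
  have e1 : s * (f * g) * t' * t = s * g := by
    rw [mul_assoc _ t', ← hg, mul_assoc, mul_assoc, hgg, ← mul_assoc, hsf]
  have e2 : t * (f * g) * s' * s = t * f := by
    rw [mul_assoc _ s', ← hf, hfg, mul_assoc, mul_assoc, hff, ← mul_assoc, htg]
  have e3 : t * (f * g) * s' * (s * (f * g) * t') = t * (f * g) * t' := by
    rw [mul_assoc s, ← mul_assoc _ s, e2, mul_assoc, ← mul_assoc f, ← mul_assoc f, hff, ← mul_assoc]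
  have e4 : s * (f * g) * t' * (t * (f * g) * s') = s * (f * g) * s' := by
    rw [mul_assoc t, ← mul_assoc _ t, e1, hfg, mul_assoc, ← mul_assoc g, ← mul_assoc g, hgg,
      ← mul_assoc]
  -- This arrow restricts `s * t'` to the common part `f * g`; right multiplication by `t` will give
  -- the middle link from `s * g` to `t * f`.
  have hp : InversePair (s * (f * g) * t') (t * (f * g) * s') := by
    constructor
    · rw [mul_assoc, e3, mul_assoc t, ← mul_assoc _ t, e1, hfg, mul_assoc, ← mul_assoc g,
        ← mul_assoc g, hgg, ← mul_assoc]
    · rw [mul_assoc, e4, mul_assoc s, ← mul_assoc _ s, e2, mul_assoc, ← mul_assoc f,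
        ← mul_assoc f, hff, ← mul_assoc]
  have h3 : σ.r (s * (f * g) * t', m) (t * (f * g) * t', n) := by
    have := groupoid _ _ m n hp
    rw [e3] at this
    exact this (by simpa [mul_assoc] using ρ.mul_right _ _ (f * g * t', 1) hr)
  have h4 := σ.mul_right _ _ (t, 1) h3
  rw [Prod.mk_mul_mk, Prod.mk_mul_mk, mul_one, mul_one, e1, mul_assoc _ t', ← hg, mul_assoc t,
    mul_assoc f, hgg, hfg, ← mul_assoc t, htg] at h4
  exact σ.iseqv.trans h1 (σ.iseqv.trans h4 h2)

end RightCongruence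

theorem mainTheorem1 {S : Type*} [Semigroup S] [Nonempty S]
    (hinv : IsInverseSemigroup S) (hS : IsRightNoetherianSemigroup S)
    (M : Type*) [Monoid M] :
    IsRightNoetherianSemigroup (S × M) ↔ IsRightNoetherianSemigroup M :=
  ⟨fun h => h.of_surjective (MulHom.snd S M) Prod.snd_surjective,
    fun hM ρ => ρ.finitelyGenerated_prod hinv hS hM⟩
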